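/- Let $\mathbb{Q}(2^\infty)=\mathbb{Q}(\{\sqrt m : m\in\mathbb{Z}\})$, and let $E: y^2=x^3+Ax+B$ with $A,B\in\mathbb{Q}(2^\infty)$ be an elliptic curve over $\mathbb{Q}(2^\infty)$ whose $j$-invariant $j=j(E)$ lies in $\mathbb{Q}\setminus\{0,1728\}$. Let $E': y^2=x^3+A'x+B'$ with $A'=-\frac{27j}{j-1728}$ and $B'=\frac{54j}{j-1728}$; this is an elliptic curve over $\mathbb{Q}$ with $j(E')=j$, and it is the quadratic twist $E^D: y^2=x^3+AD^2x+BD^3$ of $E$ by $D=\frac{AB'}{BA'}\in\mathbb{Q}(2^\infty)$. Put $L=\mathbb{Q}(2^\infty)(\sqrt D)$, the field over which the isomorphism $E\to E'$, $(x,y)\mapsto(xD,\,yD\sqrt D)$, is defined. If $E(\mathbb{Q}(2^\infty))$ has a point of order $5$, then $L/\mathbb{Q}$ is an abelian extension, that is, a Galois extension with commutative Galois group. -/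

import Mathlib

/-- The field `ℚ(2^∞) = ℚ({√m : m ∈ ℤ})`, inside a fixed algebraic closure of `ℚ`. -/
noncomputable def QTwoInf : IntermediateField ℚ (AlgebraicClosure ℚ) :=
  IntermediateField.adjoin ℚ {x | ∃ m : ℤ, x ^ 2 = (m : AlgebraicClosure ℚ)}

/-- The curve `E' : y² = x³ - (27j/(j - 1728)) x + 54j/(j - 1728)` over `ℚ`,
which for `j ≠ 0, 1728` is an elliptic curve of `j`-invariant `j`. -/
def rationalModel (j : ℚ) : WeierstrassCurve ℚ where
  a₁ := 0
  a₂ := 0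
  a₃ := 0
  a₄ := -(27 * j / (j - 1728))
  a₆ := 54 * j / (j - 1728)

/-- For `E : y² = x³ + Ax + B` over `ℚ(2^∞)` and `E' : y² = x³ + A'x + B'` over `ℚ` with the same
`j`-invariant `j ≠ 0, 1728`, the element `D = AB' / (BA')` of `ℚ(2^∞)` for which `E'` is the
quadratic twist `E^D : y² = x³ + AD²x + BD³`. -/
noncomputable def twistFactor (E : WeierstrassCurve QTwoInf) (j : ℚ) : QTwoInf :=
  (E.a₄ * ((rationalModel j).a₆ : QTwoInf)) / (E.a₆ * ((rationalModel j).a₄ : QTwoInf))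

/-- The field `L = ℚ(2^∞)(√D)`, as an extension of `ℚ`
(adjoining both square roots of `D` is the same as adjoining one). -/
noncomputable def twistField (E : WeierstrassCurve QTwoInf) (j : ℚ) :
    IntermediateField ℚ (AlgebraicClosure ℚ) :=
  (IntermediateField.adjoin QTwoInf
    {s : AlgebraicClosure ℚ | s ^ 2 = (twistFactor E j : AlgebraicClosure ℚ)}).restrictScalars ℚ

/-! Curves with a point of order 5 form a family in s, up to a scaling q
(`coefficients_of_addOrderOf_eq_five`). Doubling the point replaces s by -1/s, so t = s - 11 - 1/s
depends only on the subgroup it generates, and (t² + 10t + 5)³ = jt.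

Rationals are squares in ℚ(2^∞), so c₆² = (j - 1728)Δ, with Δ equal to t up to squares, makes t a
square there. By `exists_rat_of_resolvent`, t is then rational, so the only possible conjugates of s
are s and -1/s.

Modulo squares of ℚ(2^∞), c₄ is trivial and D is c₆, hence s² + 1. Since s⁻² + 1 = (s² + 1)/s²,
automorphisms send δ = √(s² + 1) to ±δ or ±δ/s, and these actions commute
(`isAbelianGalois_adjoin_sqrt`). -/

open WeierstrassCurve

local notation "Ω" => AlgebraicClosure ℚ

/-! ### Curves with a point of order 5 -/

/-- The coordinates of a point `(x₀, y₀)` of order `5` and of its double `(x₁, y₁)`, with the slopes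
of the tangents at these points, determine the curve. -/
lemma coefficients_of_tangent_slopes {F : Type*} [Field F] [CharZero F]
    {a b x₀ y₀ x₁ y₁ l m : F} (hE : y₀ ^ 2 = x₀ ^ 3 + a * x₀ + b) (hl : l * (2 * y₀) = 3 * x₀ ^ 2 + a)
    (hx₁ : x₁ = l ^ 2 - 2 * x₀) (hy₁ : y₁ = -(l * (x₁ - x₀) + y₀))
    (hx₀ : x₀ = m ^ 2 - 2 * x₁) (hy₀ : y₀ = m * (x₀ - x₁) + y₁) (hne : x₁ ≠ x₀) :
    ∃ s q : F, s ≠ 0 ∧ q ≠ 0 ∧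
      a = -(q ^ 4 * (s ^ 4 - 12 * s ^ 3 + 14 * s ^ 2 + 12 * s + 1)) / 48 ∧
      b = q ^ 6 * ((s ^ 2 + 1) * (s ^ 4 - 18 * s ^ 3 + 74 * s ^ 2 + 18 * s + 1)) / 864 := by
  -- The two doubling formulas give x₁ - x₀ = m² - l², which these variables factor.
  obtain ⟨p, hp⟩ : ∃ p, p = m - l := ⟨_, rfl⟩
  obtain ⟨q, hq⟩ : ∃ q, q = m + l := ⟨_, rfl⟩
  have hpq : x₁ - x₀ = p * q := by rw [hp, hq]; linear_combination hx₀ - hx₁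
  have hpq0 : p * q ≠ 0 := hpq ▸ sub_ne_zero.2 hne
  have hp0 : p ≠ 0 := left_ne_zero_of_mul hpq0
  have hq0 : q ≠ 0 := right_ne_zero_of_mul hpq0
  have hl' : l = (q - p) / 2 := by rw [hp, hq]; ring
  have hy : y₀ = -(q ^ 2 * p) / 2 := by
    have h : 2 * y₀ = -(m + l) * (x₁ - x₀) := by linear_combination hy₀ + hy₁
    rw [hpq, ← hq] at h
    linear_combination h / 2
  have hx : x₀ = (q ^ 2 - 6 * p * q + p ^ 2) / 12 := by
    have h : 3 * x₀ = l ^ 2 - p * q := by linear_combination hx₁ - hpq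
    rw [hl'] at h
    linear_combination h / 3
  have ha : a = 2 * l * y₀ - 3 * x₀ ^ 2 := by linear_combination -hl
  have hb : b = y₀ ^ 2 - x₀ ^ 3 - a * x₀ := by linear_combination -hE
  refine ⟨p / q, q, div_ne_zero hp0 hq0, hq0, ?_, ?_⟩
  · rw [ha, hl', hy, hx]; field_simp; ring
  · rw [hb, ha, hl', hy, hx]; field_simp; ring

/-- The parametrization of the short Weierstrass curves with a point of order `5`. -/
lemma coefficients_of_addOrderOf_eq_five {F : Type*} [Field F] [CharZero F] [DecidableEq F]
    (E : WeierstrassCurve F) [E.IsShortNF] (P : E.toAffine.Point) (hP : addOrderOf P = 5) :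
    ∃ s q : F, s ≠ 0 ∧ q ≠ 0 ∧
      E.a₄ = -(q ^ 4 * (s ^ 4 - 12 * s ^ 3 + 14 * s ^ 2 + 12 * s + 1)) / 48 ∧
      E.a₆ = q ^ 6 * ((s ^ 2 + 1) * (s ^ 4 - 18 * s ^ 3 + 74 * s ^ 2 + 18 * s + 1)) / 864 := by
  have hne : ∀ n : ℕ, ¬ 5 ∣ n → n • P ≠ 0 := fun n hn h ↦
    hn (hP ▸ addOrderOf_dvd_iff_nsmul_eq_zero.2 h)
  have h5 : 5 • P = 0 := hP ▸ addOrderOf_nsmul_eq_zero P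
  have h1 := E.a₁_of_isShortNF
  have h2 := E.a₂_of_isShortNF
  have h3 := E.a₃_of_isShortNF
  match P, hne, h5 with
  | .zero, hne, _ => exact absurd (by rw [one_smul]; rfl) (hne 1 (by norm_num))
  | .some x₀ y₀ h, hne, h5 =>
    set P := Affine.Point.some x₀ y₀ h with hPdef
    have hy₀ : y₀ ≠ E.toAffine.negY x₀ y₀ := fun hy ↦
      hne 2 (by norm_num) (by rw [two_nsmul]; exact Affine.Point.add_self_of_Y_eq hy)
    have hdbl := Affine.Point.add_self_of_Y_ne (h₁ := h) hy₀
    obtain ⟨l, hl⟩ : ∃ l, l = E.toAffine.slope x₀ x₀ y₀ y₀ := ⟨_, rfl⟩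
    obtain ⟨x₁, hx₁⟩ : ∃ x₁, x₁ = E.toAffine.addX x₀ x₀ l := ⟨_, rfl⟩
    obtain ⟨y₁, hy₁⟩ : ∃ y₁, y₁ = E.toAffine.addY x₀ x₀ y₀ l := ⟨_, rfl⟩
    obtain ⟨h', hQ⟩ : ∃ h' : E.toAffine.Nonsingular x₁ y₁, P + P = .some x₁ y₁ h' := by
      subst hl hx₁ hy₁; exact ⟨_, hdbl⟩
    have hy₁' : y₁ ≠ E.toAffine.negY x₁ y₁ := fun hy ↦
      hne 4 (by norm_num) (by
        rw [show (4 : ℕ) = 2 * 2 from rfl, mul_nsmul, two_nsmul, two_nsmul, hQ]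
        exact Affine.Point.add_self_of_Y_eq hy)
    have hquad := Affine.Point.add_self_of_Y_ne (h₁ := h') hy₁'
    -- Order 5 enters as 2(2P) = -P: the tangent at 2P, of slope m, meets the curve again at P.
    have hneg : P + P + (P + P) = -P := by
      rw [eq_neg_iff_add_eq_zero, ← h5]; abel
    rw [← hQ, hneg, hPdef, Affine.Point.neg_some, Affine.Point.some.injEq] at hquad
    have hx : x₁ ≠ x₀ := fun hx ↦ by
      rcases Affine.Point.X_eq_iff (h₁ := h') (h₂ := h).1 hx with h | h
      · rw [← hQ, ← hPdef] at h
        exact hne 1 (by norm_num) (by rw [one_nsmul]; exact add_eq_left.1 h)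
      · rw [← hQ, ← hPdef] at h
        exact hne 3 (by norm_num) (by rw [succ_nsmul, two_nsmul, h, neg_add_cancel])
    have hEq := (E.toAffine.equation_iff x₀ y₀).1 h.1
    rw [Affine.slope_of_Y_ne rfl hy₀] at hl
    rw [Affine.slope_of_Y_ne rfl hy₁'] at hquad
    obtain ⟨hqx, hqy⟩ := hquad
    obtain ⟨m, hm⟩ : ∃ m, m = (3 * x₁ ^ 2 + 2 * E.a₂ * x₁ + E.a₄ - E.a₁ * y₁) /
      (y₁ - E.toAffine.negY x₁ y₁) := ⟨_, rfl⟩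
    rw [← hm] at hqx hqy
    rw [eq_div_iff (sub_ne_zero.2 hy₀)] at hl
    simp only [Affine.addX, Affine.addY, Affine.negAddY, Affine.negY, h1, h2, h3]
      at hEq hl hx₁ hy₁ hqx hqy
    refine coefficients_of_tangent_slopes (x₀ := x₀) (y₀ := y₀) (x₁ := x₁) (y₁ := y₁) (l := l)
      (m := m) ?_ ?_ ?_ ?_ ?_ ?_ hx
    · linear_combination hEq
    · linear_combination hl
    · linear_combination hx₁
    · rw [hy₁, hx₁]; ring
    · linear_combination hqx
    · linear_combination -hqy - m * hqx

/-! ### The resolvent of the subgroups of order 5 -/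

/-- Two distinct roots of `(t² + 10t + 5)³ = jt` have as product `5` times a symmetric square. -/
lemma resolvent_relation {F : Type*} [Field F] {j t₁ t₂ : F} (hne : t₁ ≠ t₂)
    (h₁ : (t₁ ^ 2 + 10 * t₁ + 5) ^ 3 = j * t₁) (h₂ : (t₂ ^ 2 + 10 * t₂ + 5) ^ 3 = j * t₂) :
    5 * ((t₁ + t₂ + 9) * (t₁ * t₂) + 5) ^ 2 =
      t₁ * t₂ * ((t₁ + t₂) ^ 2 + 15 * (t₁ + t₂) + 45 + t₁ * t₂) ^ 2 := by
  apply mul_left_cancel₀ (sub_ne_zero.2 hne)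
  linear_combination t₁ * h₂ - t₂ * h₁

/-- If the right-hand factor vanishes, so does the left-hand one. Eliminating t₁t₂ leaves t₁ + t₂ =
-4 or -10, with t₁t₂ = -1 or 5 respectively, so t₁ is a root of one of the two excluded quadratics.
-/
lemma resolvent_denominator_ne_zero {F : Type*} [Field F] [CharZero F] {t₁ t₂ : F}
    (h : 5 * ((t₁ + t₂ + 9) * (t₁ * t₂) + 5) ^ 2 =
      t₁ * t₂ * ((t₁ + t₂) ^ 2 + 15 * (t₁ + t₂) + 45 + t₁ * t₂) ^ 2)
    (h4 : t₁ ^ 2 + 10 * t₁ + 5 ≠ 0) (h6 : t₁ ^ 2 + 4 * t₁ - 1 ≠ 0) :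
    (t₁ + t₂) ^ 2 + 15 * (t₁ + t₂) + 45 + t₁ * t₂ ≠ 0 := by
  intro hB
  have hA : (t₁ + t₂ + 9) * (t₁ * t₂) + 5 = 0 := by
    rw [hB] at h; simpa using h
  have he : (t₁ + t₂ + 4) * (t₁ + t₂ + 10) ^ 2 = 0 := by
    linear_combination (t₁ + t₂ + 9) * hB - hA
  rcases mul_eq_zero.1 he with he | he
  · apply h6
    linear_combination (t₁ + (t₁ + t₂) + 11) * he - hB
  · have he := pow_eq_zero_iff (two_ne_zero) |>.1 he
    apply h4
    linear_combination (t₁ + (t₁ + t₂) + 5) * he - hB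

/-! ### Automorphisms on ℚ(2^∞) -/

lemma eq_or_eq_neg_of_map_sq_eq {R : Type*} [Field R] [Algebra ℚ R] (σ : R ≃ₐ[ℚ] R) {x y : R}
    (h : σ (x ^ 2) = y ^ 2) : σ x = y ∨ σ x = -y := by
  rw [map_pow] at h; exact sq_eq_sq_iff_eq_or_eq_neg.1 h

namespace QTwoInf

lemma map_mem (σ : Ω ≃ₐ[ℚ] Ω) {x : Ω} (hx : x ∈ QTwoInf) : σ x ∈ QTwoInf := by
  induction hx using IntermediateField.adjoin_induction with
  | mem x hx =>
    obtain ⟨m, hm⟩ := hx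
    exact IntermediateField.subset_adjoin _ _ ⟨m, by rw [← map_pow, hm, map_intCast]⟩
  | algebraMap r => rw [AlgEquiv.commutes]; exact IntermediateField.algebraMap_mem _ _
  | add x y _ _ hx hy => rw [map_add]; exact add_mem hx hy
  | inv x _ hx => rw [map_inv₀]; exact inv_mem hx
  | mul x y _ _ hx hy => rw [map_mul]; exact mul_mem hx hy

lemma map_eq_or_eq_neg (σ : Ω ≃ₐ[ℚ] Ω) {x : Ω} (hx : ∃ m : ℤ, x ^ 2 = (m : Ω)) :
    σ x = x ∨ σ x = -x := by
  obtain ⟨m, hm⟩ := hx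
  exact eq_or_eq_neg_of_map_sq_eq σ (by rw [hm, map_intCast])

lemma map_comm (σ τ : Ω ≃ₐ[ℚ] Ω) {x : Ω} (hx : x ∈ QTwoInf) : σ (τ x) = τ (σ x) := by
  induction hx using IntermediateField.adjoin_induction with
  | mem x hx =>
    rcases map_eq_or_eq_neg σ hx with h | h <;> rcases map_eq_or_eq_neg τ hx with h' | h' <;>
      simp [h, h']
  | algebraMap r => simp only [AlgEquiv.commutes]
  | add x y _ _ hx hy => simp only [map_add, hx, hy]
  | inv x _ hx => simp only [map_inv₀, hx]
  | mul x y _ _ hx hy => simp only [map_mul, hx, hy]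

lemma map_map (σ : Ω ≃ₐ[ℚ] Ω) {x : Ω} (hx : x ∈ QTwoInf) : σ (σ x) = x := by
  induction hx using IntermediateField.adjoin_induction with
  | mem x hx => rcases map_eq_or_eq_neg σ hx with h | h <;> simp [h]
  | algebraMap r => simp only [AlgEquiv.commutes]
  | add x y _ _ hx hy => simp only [map_add, hx, hy]
  | inv x _ hx => simp only [map_inv₀, hx]
  | mul x y _ _ hx hy => simp only [map_mul, hx, hy]

lemma exists_sq_eq_rat (r : ℚ) : ∃ x ∈ QTwoInf, x ^ 2 = (r : Ω) := by
  obtain ⟨z, hz⟩ := IsAlgClosed.exists_pow_nat_eq ((r.num * r.den : ℤ) : Ω) (n := 2) two_pos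
  have hd : (r.den : Ω) ≠ 0 := Nat.cast_ne_zero.2 r.den_ne_zero
  refine ⟨z / r.den, div_mem (IntermediateField.subset_adjoin _ _ ⟨_, hz⟩) (natCast_mem _ _), ?_⟩
  rw [div_pow, hz, Rat.cast_def]
  push_cast
  field_simp

end QTwoInf

/-! ### Rationality of the resolvent root -/

instance isGalois_algebraicClosure_rat : IsGalois ℚ Ω := by
  have h : @IsGalois ℚ _ Ω _ (AlgebraicClosure.instAlgebra ℚ) := inferInstance
  convert h
  exact Subsingleton.elim _ _

lemma exists_rat_of_fixed {x : Ω} (h : ∀ σ : Ω ≃ₐ[ℚ] Ω, σ x = x) : ∃ r : ℚ, (r : Ω) = x := by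
  obtain ⟨r, hr⟩ := IntermediateField.mem_bot.1 ((InfiniteGalois.mem_bot_iff_fixed x).2 h)
  exact ⟨r, by rw [← hr]; rfl⟩

lemma exists_map_ne_of_sq_eq_five {x : Ω} (hx : x ^ 2 = 5) : ∃ σ : Ω ≃ₐ[ℚ] Ω, σ x ≠ x := by
  by_contra! h
  obtain ⟨r, rfl⟩ := exists_rat_of_fixed h
  have hr : r ^ 2 = 5 := by exact_mod_cast hx
  refine (Nat.prime_five.irrational_sqrt).ne_rat |r| ?_
  rw [Real.sqrt_eq_iff_mul_self_eq (by norm_num) (by positivity)]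
  have : |r| * |r| = 5 := by rw [abs_mul_abs_self, ← sq, hr]
  exact_mod_cast this.symm

/-- A root `t = θ²` of the resolvent of the cyclic subgroups of order `5`, with `θ` in `ℚ(2^∞)`, is
rational: the product of two such conjugate `θ` is `√5` times a symmetric function of their squares,
hence otherwise all automorphisms would fix `√5`. -/
lemma exists_rat_of_resolvent {j : ℚ} {t θ : Ω} (hθ : θ ∈ QTwoInf) (ht : t = θ ^ 2) (ht0 : t ≠ 0)
    (hj : (t ^ 2 + 10 * t + 5) ^ 3 = j * t) (h4 : t ^ 2 + 10 * t + 5 ≠ 0)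
    (h6 : t ^ 2 + 4 * t - 1 ≠ 0) : ∃ r : ℚ, (r : Ω) = t := by
  have htK : t ∈ QTwoInf := ht ▸ pow_mem hθ 2
  have hθ0 : θ ≠ 0 := by rintro rfl; simp at ht; exact ht0 ht
  have key : ∀ w : Ω ≃ₐ[ℚ] Ω, w t ≠ t → ∃ A B : Ω, B ≠ 0 ∧
      5 * A ^ 2 = (θ * w θ * B) ^ 2 ∧
      (∀ σ : Ω ≃ₐ[ℚ] Ω, (σ t = t ∧ σ (w t) = w t) ∨ (σ t = w t ∧ σ (w t) = t) → σ A = A ∧ σ B = B) := by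
    intro w hw
    have hwj : (w t ^ 2 + 10 * w t + 5) ^ 3 = j * w t := by
      simpa [map_ofNat w 10, map_ofNat w 5] using congrArg w hj
    have hrel := resolvent_relation hw.symm hj hwj
    refine ⟨(t + w t + 9) * (t * w t) + 5, _, resolvent_denominator_ne_zero hrel h4 h6, ?_, ?_⟩
    · rw [hrel, mul_pow, mul_pow, ← map_pow, ← ht]
    · rintro σ (⟨h, h'⟩ | ⟨h, h'⟩)
      · simp only [map_add, map_mul, map_pow, map_ofNat, h, h', and_self]
      · simp only [map_add, map_mul, map_pow, map_ofNat, h, h']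
        constructor <;> ring
  have sqrtFive : ∀ w : Ω ≃ₐ[ℚ] Ω, w t ≠ t → ∃ ρ : Ω, ρ ^ 2 = 5 ∧ w ρ = ρ ∧
      ∀ σ : Ω ≃ₐ[ℚ] Ω, σ t = t → σ ρ = ρ := by
    intro w hw
    obtain ⟨A, B, hB, hAB, hinv⟩ := key w hw
    have hw0 : w θ ≠ 0 := by simpa using hθ0
    have hA : A ≠ 0 := by
      rintro rfl
      have : θ * w θ * B ≠ 0 := mul_ne_zero (mul_ne_zero hθ0 hw0) hB
      rw [zero_pow two_ne_zero, mul_zero] at hAB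
      exact pow_ne_zero 2 this hAB.symm
    refine ⟨θ * w θ * B / A, ?_, ?_, ?_⟩
    · rw [div_pow, ← hAB]; field_simp
    -- On ℚ(2^∞) the automorphism w is an involution, so it swaps θ and w θ.
    · obtain ⟨hA', hB'⟩ := hinv w (Or.inr ⟨rfl, QTwoInf.map_map w htK⟩)
      rw [map_div₀, map_mul, map_mul, hA', hB', QTwoInf.map_map w hθ, mul_comm (w θ)]
    · intro σ hσ
      -- Since σ commutes with w there, θ and w θ change by the same sign.
      obtain ⟨hA', hB'⟩ := hinv σ (Or.inl ⟨hσ, by rw [QTwoInf.map_comm σ w htK, hσ]⟩)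
      rw [map_div₀, map_mul, map_mul, hA', hB', QTwoInf.map_comm σ w hθ]
      rcases eq_or_eq_neg_of_map_sq_eq σ (x := θ) (y := θ) (by rw [← ht, hσ]) with h | h <;> simp [h]
  refine exists_rat_of_fixed fun w ↦ ?_
  by_contra hw
  obtain ⟨ρ, hρ, hwρ, hfix⟩ := sqrtFive w hw
  obtain ⟨σ, hσ⟩ := exists_map_ne_of_sq_eq_five hρ
  -- The stabilizer of t fixes √5 by the choice of ρ; an automorphism moving t fixes its own root ρ'
  -- = ±ρ. So no σ moves √5.
  by_cases hσt : σ t = t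
  · exact hσ (hfix σ hσt)
  · obtain ⟨ρ', hρ', hσρ', -⟩ := sqrtFive σ hσt
    rcases sq_eq_sq_iff_eq_or_eq_neg.1 (hρ.trans hρ'.symm) with h | h
    · exact hσ (by rw [h, hσρ'])
    · exact hσ (by rw [h, map_neg, hσρ'])

/-! ### Adjoining the square root of s² + 1 -/

lemma isAbelianGalois_of_map_comm {F Λ : Type*} [Field F] [Field Λ] [Algebra F Λ] [IsGalois F Λ]
    (M : IntermediateField F Λ) (hmap : ∀ σ : Λ ≃ₐ[F] Λ, ∀ x ∈ M, σ x ∈ M)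
    (hcomm : ∀ σ τ : Λ ≃ₐ[F] Λ, ∀ x ∈ M, σ (τ x) = τ (σ x)) : IsAbelianGalois F M := by
  have hN : Normal F M := by
    rw [IntermediateField.normal_iff_forall_map_le']
    rintro σ _ ⟨x, hx, rfl⟩
    exact hmap σ x hx
  have : IsGalois F M := ⟨⟩
  refine { is_comm := ⟨fun f g ↦ ?_⟩ }
  obtain ⟨σ, rfl⟩ := AlgEquiv.restrictNormalHom_surjective (F := F) (K₁ := M) Λ f
  obtain ⟨τ, rfl⟩ := AlgEquiv.restrictNormalHom_surjective (F := F) (K₁ := M) Λ g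
  ext x
  simpa [AlgEquiv.restrictNormalHom_apply] using hcomm σ τ x x.2

/-- If `s - 1/s` is rational, then adjoining the square root of a square multiple of `s² + 1` to
`ℚ(2^∞)` yields an abelian extension of `ℚ`. -/
lemma isAbelianGalois_adjoin_sqrt {d s k : Ω} {u : ℚ} (hs : s ∈ QTwoInf) (hk : k ∈ QTwoInf)
    (hs0 : s ≠ 0) (hk0 : k ≠ 0) (hu : s ^ 2 - u * s - 1 = 0) (hd : d = (s ^ 2 + 1) * k ^ 2) :
    IsAbelianGalois ℚ ((IntermediateField.adjoin QTwoInf {x : Ω | x ^ 2 = d}).restrictScalars ℚ) := by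
  have hK : ∀ {x : Ω}, x ∈ QTwoInf → x ∈ IntermediateField.adjoin QTwoInf {x : Ω | x ^ 2 = d} :=
    fun {x} hx ↦ IntermediateField.algebraMap_mem _ (⟨x, hx⟩ : QTwoInf)
  obtain ⟨δ, hδ⟩ := IsAlgClosed.exists_pow_nat_eq (s ^ 2 + 1) (n := 2) two_pos
  have hδL : δ ∈ IntermediateField.adjoin QTwoInf {x : Ω | x ^ 2 = d} := by
    have h : δ * k ∈ IntermediateField.adjoin QTwoInf {x : Ω | x ^ 2 = d} :=
      IntermediateField.subset_adjoin _ _ (by simp [mul_pow, hδ, hd])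
    simpa [hk0] using div_mem h (hK hk)
  have hgen : ∀ x : Ω, x ^ 2 = d → x = δ * k ∨ x = -(δ * k) := fun x hx ↦
    sq_eq_sq_iff_eq_or_eq_neg.1 (by rw [hx, hd, mul_pow, hδ])
  have hσ : ∀ σ : Ω ≃ₐ[ℚ] Ω, (σ s = s ∧ (σ δ = δ ∨ σ δ = -δ)) ∨
      (σ s = -s⁻¹ ∧ (σ δ = δ / s ∨ σ δ = -(δ / s))) := by
    intro σ
    have hσu : (σ s) ^ 2 - u * σ s - 1 = 0 := by simpa using congrArg σ hu
    -- The roots of X² - uX - 1 have product -1.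
    have : (σ s - s) * (s * σ s + 1) = 0 := by linear_combination s * hσu - σ s * hu
    rcases mul_eq_zero.1 this with h | h
    · have h := sub_eq_zero.1 h
      exact Or.inl ⟨h, eq_or_eq_neg_of_map_sq_eq σ (by rw [hδ]; simp [h])⟩
    · have h : σ s = -s⁻¹ := by field_simp; linear_combination h
      refine Or.inr ⟨h, eq_or_eq_neg_of_map_sq_eq σ ?_⟩
      rw [div_pow, hδ]
      simp only [map_add, map_pow, map_one, h]
      field_simp
      ring
  convert isAbelianGalois_of_map_comm
    ((IntermediateField.adjoin QTwoInf {x : Ω | x ^ 2 = d}).restrictScalars ℚ) ?_ ?_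
  · exact Subsingleton.elim _ _
  · intro σ x hx
    rw [IntermediateField.mem_restrictScalars] at hx ⊢
    have hσδ : σ δ ∈ IntermediateField.adjoin QTwoInf {x : Ω | x ^ 2 = d} := by
      rcases hσ σ with ⟨-, h | h⟩ | ⟨-, h | h⟩ <;> rw [h]
      · exact hδL
      · exact neg_mem hδL
      · exact div_mem hδL (hK hs)
      · exact neg_mem (div_mem hδL (hK hs))
    have hσk := hK (QTwoInf.map_mem σ hk)
    induction hx using IntermediateField.adjoin_induction with
    | mem x hx =>
      rcases hgen x hx with rfl | rfl
      · rw [map_mul]; exact mul_mem hσδ hσk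
      · rw [map_neg, map_mul]; exact neg_mem (mul_mem hσδ hσk)
    | algebraMap r => exact hK (QTwoInf.map_mem σ r.2)
    | add x y _ _ hx hy => rw [map_add]; exact add_mem hx hy
    | inv x _ hx => rw [map_inv₀]; exact inv_mem hx
    | mul x y _ _ hx hy => rw [map_mul]; exact mul_mem hx hy
  · intro σ τ x hx
    rw [IntermediateField.mem_restrictScalars] at hx
    have hστ : σ (τ δ) = τ (σ δ) := by
      rcases hσ σ with ⟨hs, h | h⟩ | ⟨hs, h | h⟩ <;> rcases hσ τ with ⟨hs', h' | h'⟩ | ⟨hs', h' | h'⟩ <;>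
        simp only [map_neg, map_div₀, h, h', hs, hs'] <;> field_simp
    induction hx using IntermediateField.adjoin_induction with
    | mem x hx =>
      rcases hgen x hx with rfl | rfl <;> simp only [map_neg, map_mul, hστ, QTwoInf.map_comm σ τ hk]
    | algebraMap r => exact QTwoInf.map_comm σ τ r.2
    | add x y _ _ hx hy => simp only [map_add, hx, hy]
    | inv x _ hx => simp only [map_inv₀, hx]
    | mul x y _ _ hx hy => simp only [map_mul, hx, hy]

/-! ### The invariants and the twist factor -/

lemma j_mul_of_coefficients {F : Type*} [Field F] [CharZero F] (E : WeierstrassCurve F)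
    [E.IsShortNF] [E.IsElliptic] {s q : F} (hq : q ≠ 0)
    (h₄ : E.a₄ = -(q ^ 4 * (s ^ 4 - 12 * s ^ 3 + 14 * s ^ 2 + 12 * s + 1)) / 48)
    (h₆ : E.a₆ = q ^ 6 * ((s ^ 2 + 1) * (s ^ 4 - 18 * s ^ 3 + 74 * s ^ 2 + 18 * s + 1)) / 864) :
    s ^ 5 * (s ^ 2 - 11 * s - 1) ≠ 0 ∧
    (s ^ 4 - 12 * s ^ 3 + 14 * s ^ 2 + 12 * s + 1) ^ 3 = E.j * (s ^ 5 * (s ^ 2 - 11 * s - 1)) := by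
  have hΔ : E.Δ = q ^ 12 * (s ^ 5 * (s ^ 2 - 11 * s - 1)) := by
    rw [Δ_of_isShortNF, h₄, h₆]; ring
  have hc₄ : E.c₄ = q ^ 4 * (s ^ 4 - 12 * s ^ 3 + 14 * s ^ 2 + 12 * s + 1) := by
    rw [c₄_of_isShortNF, h₄]; ring
  have hΔ0 : E.Δ ≠ 0 := E.isUnit_Δ.ne_zero
  refine ⟨fun h ↦ hΔ0 (by rw [hΔ, h, mul_zero]), ?_⟩
  have hj : E.j * E.Δ = E.c₄ ^ 3 := by
    rw [WeierstrassCurve.j, ← E.coe_Δ', mul_right_comm, Units.inv_mul, one_mul]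
  rw [hΔ, hc₄] at hj
  apply mul_left_cancel₀ (pow_ne_zero 12 hq)
  linear_combination -hj

theorem proposition5 [DecidableEq QTwoInf]
    (E : WeierstrassCurve QTwoInf) [E.IsShortNF] [E.IsElliptic]
    (j : ℚ) (hj : E.j = (j : QTwoInf)) (hj0 : j ≠ 0) (hj1728 : j ≠ 1728)
    (h5 : ∃ P : E.toAffine.Point, addOrderOf P = 5) :
    IsAbelianGalois ℚ (twistField E j) := by
  obtain ⟨P, hP⟩ := h5
  obtain ⟨σ, ξ, hs0, hq0, h₄, h₆⟩ := coefficients_of_addOrderOf_eq_five E P hP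
  obtain ⟨hΔ0, hc₄⟩ := j_mul_of_coefficients E hq0 h₄ h₆
  rw [hj] at hc₄
  replace h₄ := congrArg (algebraMap QTwoInf Ω) h₄
  replace h₆ := congrArg (algebraMap QTwoInf Ω) h₆
  replace hc₄ := congrArg (algebraMap QTwoInf Ω) hc₄
  replace hs0 := (map_ne_zero (algebraMap QTwoInf Ω)).2 hs0
  replace hq0 := (map_ne_zero (algebraMap QTwoInf Ω)).2 hq0
  replace hΔ0 := (map_ne_zero (algebraMap QTwoInf Ω)).2 hΔ0
  have hmem : ∀ x : QTwoInf, algebraMap QTwoInf Ω x ∈ QTwoInf := Subtype.property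
  have hs := hmem σ
  have hq := hmem ξ
  have hc₄K := hmem (σ ^ 4 - 12 * σ ^ 3 + 14 * σ ^ 2 + 12 * σ + 1)
  have hc₆K := hmem ((σ ^ 2 + 1) * (σ ^ 4 - 18 * σ ^ 3 + 74 * σ ^ 2 + 18 * σ + 1))
  simp only [map_mul, map_neg, map_div₀, map_add, map_sub, map_pow, map_one, map_ofNat,
    map_ratCast] at h₄ h₆ hc₄ hΔ0 hc₄K hc₆K
  generalize algebraMap QTwoInf Ω σ = s at *
  generalize algebraMap QTwoInf Ω ξ = q at *
  have hjΩ : (j : Ω) ≠ 0 := by exact_mod_cast hj0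
  have hj' : (j : Ω) - 1728 ≠ 0 := sub_ne_zero.2 (by exact_mod_cast hj1728)
  obtain ⟨m, hm, hm2⟩ := QTwoInf.exists_sq_eq_rat (j - 1728)
  obtain ⟨k, hk, hk2⟩ := QTwoInf.exists_sq_eq_rat j
  push_cast at hm2
  set c₄ := s ^ 4 - 12 * s ^ 3 + 14 * s ^ 2 + 12 * s + 1
  set c₆ := (s ^ 2 + 1) * (s ^ 4 - 18 * s ^ 3 + 74 * s ^ 2 + 18 * s + 1)
  have hc₆ : c₆ ^ 2 = (j - 1728) * (s ^ 5 * (s ^ 2 - 11 * s - 1)) := by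
    rw [sub_mul, ← hc₄]; simp only [c₄, c₆]; ring
  have hc₄0 : c₄ ≠ 0 := by
    intro h
    rw [h, zero_pow three_ne_zero] at hc₄
    exact mul_ne_zero hjΩ hΔ0 hc₄.symm
  have hc₆0 : c₆ ≠ 0 := by
    intro h
    rw [h, zero_pow two_ne_zero] at hc₆
    exact mul_ne_zero hj' hΔ0 hc₆.symm
  have hm0 : m ≠ 0 := by rintro rfl; exact hj' (by rw [← hm2]; ring)
  have hk0 : k ≠ 0 := by rintro rfl; exact hjΩ (by rw [← hk2]; ring)
  obtain ⟨t, ht⟩ : ∃ t, t = s - 11 - 1 / s := ⟨_, rfl⟩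
  have hst : s * t = s ^ 2 - 11 * s - 1 := by rw [ht]; field_simp
  have hΔt : s ^ 5 * (s ^ 2 - 11 * s - 1) = s ^ 6 * t := by rw [← hst]; ring
  have hc₄t : c₄ = s ^ 2 * (t ^ 2 + 10 * t + 5) := by
    simp only [c₄, ht]; field_simp; ring
  have hc₆t : c₆ = s ^ 2 * (s ^ 2 + 1) * (t ^ 2 + 4 * t - 1) := by
    simp only [c₆, ht]; field_simp; ring
  rw [hΔt] at hΔ0 hc₄ hc₆
  clear_value c₄ c₆
  have ht0 : t ≠ 0 := right_ne_zero_of_mul hΔ0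
  have h4t : t ^ 2 + 10 * t + 5 ≠ 0 := fun h ↦ hc₄0 (by rw [hc₄t, h, mul_zero])
  have h6t : t ^ 2 + 4 * t - 1 ≠ 0 := fun h ↦ hc₆0 (by rw [hc₆t, h, mul_zero])
  obtain ⟨r, rfl⟩ : ∃ r : ℚ, (r : Ω) = t := by
    -- This θ is the square root of t read off from c₆² = (j - 1728)s⁶t.
    refine exists_rat_of_resolvent (j := j) (θ := c₆ / (s ^ 3 * m))
      (div_mem hc₆K (mul_mem (pow_mem hs 3) hm)) ?_ ht0 ?_ h4t h6t
    · rw [div_pow, hc₆, mul_pow, hm2]; field_simp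
    · apply mul_left_cancel₀ (pow_ne_zero 6 hs0)
      rw [hc₄t] at hc₄
      linear_combination hc₄
  -- Now that t = r is rational, the factor t² + 4t - 1 of c₆ is a square in ℚ(2^∞).
  obtain ⟨n, hn, hn2⟩ := QTwoInf.exists_sq_eq_rat (r ^ 2 + 4 * r - 1)
  push_cast at hn2
  have hn0 : n ≠ 0 := by rintro rfl; exact h6t (by rw [← hn2]; ring)
  refine isAbelianGalois_adjoin_sqrt (s := s) (u := r + 11)
    (k := 6 * (k * c₆ / (m * c₄)) * (s * n) / (q * c₆)) hs ?_ hs0 ?_ ?_ ?_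
  · exact div_mem (mul_mem (mul_mem (ofNat_mem _ 6) (div_mem (mul_mem hk hc₆K) (mul_mem hm hc₄K)))
      (mul_mem hs hn)) (mul_mem hq hc₆K)
  · simp [hk0, hc₆0, hm0, hc₄0, hs0, hn0, hq0]
  · push_cast; linear_combination -hst
  · have hD : ((twistFactor E j : QTwoInf) : Ω) = 36 * c₄ / (q ^ 2 * c₆) := by
      change algebraMap QTwoInf Ω (twistFactor E j) = _
      simp only [twistFactor, rationalModel, map_div₀, map_mul, map_ratCast, h₄, h₆]
      push_cast
      field_simp
      ring
    rw [hD]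
    -- From c₄³/c₆² = j/(j - 1728), where numerator and denominator are squares in ℚ(2^∞).
    have hsq : c₄ = (k * c₆ / (m * c₄)) ^ 2 := by
      rw [div_pow, mul_pow k, mul_pow m, hk2, hm2, hc₆]
      field_simp
      linear_combination hc₄
    have hc₆n : c₆ = (s ^ 2 + 1) * (s * n) ^ 2 := by
      rw [hc₆t, mul_pow, hn2]; ring
    calc 36 * c₄ / (q ^ 2 * c₆) = c₆ * (36 * c₄ / (q * c₆) ^ 2) := by field_simp
      _ = (s ^ 2 + 1) * (s * n) ^ 2 * (36 * (k * c₆ / (m * c₄)) ^ 2 / (q * c₆) ^ 2) := by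
        rw [← hc₆n, ← hsq]
      _ = _ := by ring
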